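/- Let $\lambda\ge 1$ and let $(X,d)$ be a metric space homeomorphic to the plane $\mathbb{R}^2$. Let $\bar X$ be its metric completion and $\partial X=\bar X\setminus X$ its metric boundary. Suppose that $\bar X$ is compact and $\lambda$-LLC, that $\bar X$ is homeomorphic to the closed unit disk $\bar{\mathbb{D}}^2\subseteq\mathbb{R}^2$, and that $\partial X$ is a Jordan curve (a topologically embedded circle in $\bar X$) which, with the metric of $\bar X$, is $\lambda$-LLC. Then $\partial X$ is $2048\lambda^5$-porous in $\bar X$; in particular it is porous with a constant depending only on $\lambda$. Here $B(a,r)$ denotes an open ball, and a continuum is a compact connected set containing at least two points. A metric space $Y$ is $\lambda$-LLC ($\lambda$-linearly locally connected) if for all $a\in Y$ and $r>0$: (i) any two distinct points of $B(a,r)$ lie in a continuum $E\subseteq B(a,\lambda r)$; (ii) any two distinct points of $Y\setminus B(a,r)$ lie in a continuum $E\subseteq Y\setminus B(a,r/\lambda)$. For $C\ge 1$, a subset $S\subseteq Y$ is $C$-porous in $Y$ if for every $y\in S$ and every $0<r\le\operatorname{diam}(Y)$ there is $x\in Y$ with $B(x,r/C)\subseteq B(y,r)\setminus S$. -/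

import Mathlib

/-- A continuum: a compact connected set containing at least two points. -/
def IsContinuum {Y : Type*} [TopologicalSpace Y] (E : Set Y) : Prop :=
  IsCompact E ∧ IsConnected E ∧ E.Nontrivial

/-- `Y` is `L`-linearly locally connected (`L`-LLC), where `L ≥ 1`: two distinct points of
`B(a, r)` lie in a continuum inside `B(a, L r)`, and two distinct points outside `B(a, r)` lie in
a continuum outside `B(a, r / L)`. -/
def IsLLC (L : ℝ) (Y : Type*) [MetricSpace Y] : Prop :=
  1 ≤ L ∧ ∀ (a : Y) (r : ℝ), 0 < r →
    (∀ x ∈ Metric.ball a r, ∀ y ∈ Metric.ball a r, x ≠ y →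
      ∃ E : Set Y, IsContinuum E ∧ E ⊆ Metric.ball a (L * r) ∧ x ∈ E ∧ y ∈ E) ∧
    (∀ x ∈ (Metric.ball a r)ᶜ, ∀ y ∈ (Metric.ball a r)ᶜ, x ≠ y →
      ∃ E : Set Y, IsContinuum E ∧ E ⊆ (Metric.ball a (r / L))ᶜ ∧ x ∈ E ∧ y ∈ E)

/-- A Jordan curve: a topologically embedded circle. -/
def IsJordanCurve {Y : Type*} [TopologicalSpace Y] (J : Set Y) : Prop :=
  ∃ γ : Circle → Y, Topology.IsEmbedding γ ∧ Set.range γ = J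

/-- The metric boundary of `X`: the complement of `X` in its completion. -/
def metricBoundary (X : Type*) [MetricSpace X] : Set (UniformSpace.Completion X) :=
  (Set.range ((↑) : X → UniformSpace.Completion X))ᶜ

/-- The subset `S` of the metric space `Y` is `C`-porous, where `C ≥ 1`: for all `y ∈ S` and
`0 < r ≤ diam Y` (the diameter may be infinite) some ball of radius `r / C` lies in
`B(y, r)` and misses `S`. -/
def IsPorous {Y : Type*} [MetricSpace Y] (C : ℝ) (S : Set Y) : Prop :=
  1 ≤ C ∧ ∀ y ∈ S, ∀ r : ℝ, 0 < r → ENNReal.ofReal r ≤ Metric.ediam (Set.univ : Set Y) →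
    ∃ x : Y, Metric.ball x (r / C) ⊆ Metric.ball y r \ S

open Set Metric

/-! Let J be the boundary curve and y ∈ J. If J stays within r/4 of y, any point at distance 3r/8
from y works. Otherwise J has a point z far from y, and y, z cut J into arcs A, B. Suppose every
point of the sphere of radius t = r/8 about y were within ε of J. Then the points near A and those
near B form two closed sets covering the sphere. They are disjoint: a point near both would, by the
first LLC condition on J, be too close to y or z, the only common points of the arcs. So A crosses
the sphere only in one part and B only in the other. A disk forbids this
(`false_of_levelSet_split`): a circle-valued map glued along the sphere would have a lift whose
increments from y to z, computed along A and along B, differ by 2π. -/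

/-- A space homeomorphic to a nonempty convex set is simply connected and locally path-connected,
so circle-valued maps on it have continuous arguments. -/
theorem exists_continuous_lift_circle_exp {Y E : Type*} [TopologicalSpace Y]
    [NormedAddCommGroup E] [NormedSpace ℝ E] {s : Set E} (hs : Convex ℝ s) (hne : s.Nonempty)
    (e : Y ≃ₜ s) (g : C(Y, Circle)) : ∃ θ : C(Y, ℝ), ∀ x, Circle.exp (θ x) = g x := by
  have := hs.contractibleSpace hne
  have := hs.locallyPathConnectedSpace
  obtain ⟨p, hp⟩ := hne
  obtain ⟨c, hc⟩ := Circle.exp_surjective (g (e.symm ⟨p, hp⟩))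
  obtain ⟨F, ⟨-, hF⟩, -⟩ := Circle.isCoveringMap_exp.existsUnique_continuousMap_lifts
    (g.comp (e.symm : C(s, Y))) ⟨p, hp⟩ c hc
  refine ⟨F.comp (e : C(Y, s)), fun x => ?_⟩
  simpa using congrFun hF (e x)

/-- Two continuous arguments of one circle-valued map differ by a constant on a connected set. -/
theorem IsPreconnected.sub_eq_sub_of_circle_exp_eq {Y : Type*} [TopologicalSpace Y] {J : Set Y}
    (hJ : IsPreconnected J) {θ ψ : Y → ℝ} (hθ : ContinuousOn θ J) (hψ : ContinuousOn ψ J)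
    (h : ∀ x ∈ J, Circle.exp (θ x) = Circle.exp (ψ x)) {y z : Y} (hy : y ∈ J) (hz : z ∈ J) :
    θ y - ψ y = θ z - ψ z := by
  have hd : IsDiscrete (AddSubgroup.zmultiples (2 * Real.pi) : Set ℝ) :=
    isDiscrete_iff_discreteTopology.mpr
      (inferInstanceAs (DiscreteTopology (AddSubgroup.zmultiples (2 * Real.pi))))
  refine hJ.constant_of_mapsTo hd (hθ.sub hψ) (fun x hx => ?_) hy hz
  obtain ⟨m, hm⟩ := Circle.exp_eq_exp.mp (h x hx)
  refine AddSubgroup.mem_zmultiples_iff.mpr ⟨m, ?_⟩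
  simp [hm]

theorem ContinuousOn.if_le_const {Y : Type*} [TopologicalSpace Y] {J : Set Y} {f u v : Y → ℝ}
    {t : ℝ} (hf : Continuous f) (hu : Continuous u) (hv : Continuous v)
    (h : ∀ x ∈ J, f x = t → u x = v x) :
    ContinuousOn (fun x => if f x ≤ t then u x else v x) J := by
  rw [continuousOn_iff_continuous_domRestrict]
  exact Continuous.if_le (f := fun x : J => f x) (g := fun _ => t) (f' := fun x : J => u x)
    (g' := fun x : J => v x) (by fun_prop) (by fun_prop) (by fun_prop) (by fun_prop)
    fun x hx => h x x.2 hx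

/-- If circle-valued maps lift, a level set separating two points `y`, `z` cannot be split into two
disjoint closed parts, each of which is avoided by a connected set joining `y` to `z`. -/
theorem false_of_levelSet_split {Y : Type*} [TopologicalSpace Y] [NormalSpace Y]
    (hlift : ∀ g : C(Y, Circle), ∃ θ : C(Y, ℝ), ∀ x, Circle.exp (θ x) = g x)
    {f : Y → ℝ} (hf : Continuous f) {t : ℝ} {S T A B : Set Y} (hS : IsClosed S) (hT : IsClosed T)
    (hST : Disjoint S T) (hcover : ∀ x, f x = t → x ∈ S ∪ T)
    (hA : IsPreconnected A) (hB : IsPreconnected B)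
    (hAS : ∀ x ∈ A, f x = t → x ∈ S) (hBT : ∀ x ∈ B, f x = t → x ∈ T)
    {y z : Y} (hy : y ∈ A ∩ B) (hz : z ∈ A ∩ B) (hyt : f y < t) (htz : t < f z) : False := by
  obtain ⟨φ, hφS, hφT, -⟩ := exists_continuous_zero_one_of_isClosed hS hT hST
  have h0 : ∀ x ∈ S, φ x = 0 := fun x hx => hφS hx
  have h1 : ∀ x ∈ T, φ x = 1 := fun x hx => hφT hx
  have hpos : Continuous fun x => Real.pi * φ x := by fun_prop
  have hneg : Continuous fun x => -(Real.pi * φ x) := by fun_prop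
  have hneg' : Continuous fun x => 2 * Real.pi - Real.pi * φ x := by fun_prop
  -- At the level t the two branches of `ψ` agree on S, where φ = 0, and differ by 2π on T, where φ
  -- = 1. So `ψ` is continuous along A, its shift `χ` along B, and their common exponential
  -- everywhere.
  let ψ : Y → ℝ := fun x => if f x ≤ t then Real.pi * φ x else -(Real.pi * φ x)
  let χ : Y → ℝ := fun x => if f x ≤ t then Real.pi * φ x else 2 * Real.pi - Real.pi * φ x
  have hψχ : ∀ x, Circle.exp (χ x) = Circle.exp (ψ x) := by
    intro x
    by_cases hx : f x ≤ t
    · simp [ψ, χ, hx]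
    · simp only [ψ, χ, hx, if_false]
      exact Circle.exp_eq_exp.mpr ⟨1, by push_cast; ring⟩
  have hg : Continuous fun x => Circle.exp (ψ x) := by
    have : (fun x => Circle.exp (ψ x)) = fun x =>
        if f x ≤ t then Circle.exp (Real.pi * φ x) else Circle.exp (-(Real.pi * φ x)) := by
      ext x
      simp only [ψ]
      split_ifs <;> rfl
    rw [this]
    refine Continuous.if_le (Circle.exp.continuous.comp hpos) (Circle.exp.continuous.comp hneg)
      hf continuous_const fun x hx => ?_
    rcases hcover x hx with hx | hx
    · simp [h0 x hx]
    · rw [h1 x hx]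
      exact Circle.exp_eq_exp.mpr ⟨1, by push_cast; ring⟩
  obtain ⟨θ, hθ⟩ := hlift ⟨_, hg⟩
  have eA := hA.sub_eq_sub_of_circle_exp_eq (θ := θ) (ψ := ψ) θ.continuous.continuousOn
    (ContinuousOn.if_le_const hf hpos hneg fun x hx hxt => by simp [h0 x (hAS x hx hxt)])
    (fun x _ => hθ x) hy.1 hz.1
  have eB := hB.sub_eq_sub_of_circle_exp_eq (θ := θ) (ψ := χ) θ.continuous.continuousOn
    (ContinuousOn.if_le_const hf hpos hneg' fun x hx hxt => by
      rw [h1 x (hBT x hx hxt)]; ring)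
    (fun x _ => (hθ x).trans (hψχ x).symm) hy.2 hz.2
  -- Only the values at z differ, by 2π, so `eA` and `eB` together give 2π = 0.
  simp only [ψ, χ, hyt.le, htz.not_ge, if_true, if_false] at eA eB
  linarith [Real.pi_pos]

/-- Two points of a Jordan curve cut it into two arcs. -/
theorem IsJordanCurve.exists_arcs {Y : Type*} [TopologicalSpace Y] {J : Set Y}
    (hJ : IsJordanCurve J) {y z : Y} (hy : y ∈ J) (hz : z ∈ J) (hyz : y ≠ z) :
    ∃ A B : Set Y, IsCompact A ∧ IsCompact B ∧ IsPreconnected A ∧ IsPreconnected B ∧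
      A ∪ B = J ∧ A ∩ B = {y, z} := by
  obtain ⟨γ, hγ, rfl⟩ := hJ
  obtain ⟨a, rfl⟩ := hy
  obtain ⟨b, rfl⟩ := hz
  have hab : a ≠ b := fun h => hyz (h ▸ rfl)
  have hc : ∀ p q : Circle, IsCompact (γ '' range (Circle.path p q)) := fun p q =>
    (isCompact_range (Circle.path p q).continuous).image hγ.continuous
  have hp : ∀ p q : Circle, IsPreconnected (γ '' range (Circle.path p q)) := fun p q =>
    (isPreconnected_range (Circle.path p q).continuous).image _ hγ.continuous.continuousOn
  refine ⟨_, _, hc a b, hc b a, hp a b, hp b a, ?_, ?_⟩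
  · rw [← image_union, Circle.range_path_union_range_path hab, image_univ]
  · rw [← image_inter hγ.injective, Circle.range_path_inter_range_path hab, image_pair]

/-- The first half of the LLC condition for a subspace `J`, when `J` is covered by two closed
sets: close points of the two sets are close to a common point of them. -/
theorem IsLLC.exists_mem_inter_dist_lt {Y : Type*} [MetricSpace Y] {L : ℝ} {J A B : Set Y}
    (hJ : IsLLC L J) (hA : IsClosed A) (hB : IsClosed B) (hAB : A ∪ B = J) {u v : Y} (hu : u ∈ A)
    (hv : v ∈ B) {δ : ℝ} (huv : dist u v < δ) : ∃ w ∈ A ∩ B, dist w u < L * δ := by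
  have hδ : 0 < δ := dist_nonneg.trans_lt huv
  have hLδ : 0 < L * δ := mul_pos (by linarith [hJ.1]) hδ
  rcases eq_or_ne u v with rfl | hne
  · exact ⟨u, ⟨hu, hv⟩, by simpa using hLδ⟩
  have huJ : u ∈ J := hAB ▸ Or.inl hu
  have hvJ : v ∈ J := hAB ▸ Or.inr hv
  obtain ⟨E, ⟨-, hE, -⟩, hsub, huE, hvE⟩ := (hJ.2 ⟨u, huJ⟩ δ hδ).1 ⟨u, huJ⟩ (mem_ball_self hδ)
    ⟨v, hvJ⟩ (by simpa [Subtype.dist_eq, dist_comm] using huv) (by simpa using hne)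
  obtain ⟨w, hwE, hwA, hwB⟩ := isPreconnected_closed_iff.mp hE.isPreconnected
    (Subtype.val ⁻¹' A) (Subtype.val ⁻¹' B) (hA.preimage continuous_subtype_val)
    (hB.preimage continuous_subtype_val) (fun w _ => by simpa [← hAB] using w.2)
    ⟨_, huE, hu⟩ ⟨_, hvE, hv⟩
  exact ⟨w, ⟨hwA, hwB⟩, by simpa [Subtype.dist_eq] using hsub hwE⟩

/-- A Jordan curve `J` satisfying the LLC condition, in a space on which circle-valued maps lift:
every sphere around `y ∈ J` separating `y` from another point of `J` has points far from `J`. -/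
theorem IsJordanCurve.exists_dist_eq_ball_disjoint {Y : Type*} [MetricSpace Y]
    (hlift : ∀ g : C(Y, Circle), ∃ θ : C(Y, ℝ), ∀ x, Circle.exp (θ x) = g x)
    {L : ℝ} {J : Set Y} (hJ : IsJordanCurve J) (hLLC : IsLLC L J) {y z : Y} (hy : y ∈ J)
    (hz : z ∈ J) {t ε : ℝ} (hε : 0 < ε) (ht : 6 * L * ε ≤ t) (hyz : 2 * t ≤ dist z y) :
    ∃ x, dist x y = t ∧ Disjoint (ball x ε) J := by
  have hL := hLLC.1
  have hLε : ε ≤ L * ε := by nlinarith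
  have ht0 : 0 < t := by nlinarith
  obtain ⟨A, B, hAc, hBc, hA, hB, hAB, hinter⟩ := hJ.exists_arcs hy hz
    (fun h => by rw [h, dist_self] at hyz; linarith)
  have hyAB : y ∈ A ∩ B := by simp [hinter]
  have hzAB : z ∈ A ∩ B := by simp [hinter]
  by_contra! hcon
  let N : Set Y → Set Y := fun D => {x | dist x y = t} ∩ {x | infDist x D ≤ ε}
  have hN : ∀ D, IsClosed (N D) := fun D =>
    (isClosed_eq (by fun_prop) continuous_const).inter
      (isClosed_le (continuous_infDist_pt D) continuous_const)
  -- The factor 2 makes the inequality strict, so that an actual point of D realizes it.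
  have hnear : ∀ {D : Set Y}, D.Nonempty → ∀ {x}, x ∈ N D → ∃ u ∈ D, dist x u < 2 * ε :=
    fun hD x hx => (infDist_lt_iff hD).mp (lt_of_le_of_lt hx.2 (by linarith))
  have hmem : ∀ {D : Set Y} {x u}, dist x y = t → u ∈ D → dist x u < ε → x ∈ N D :=
    fun hx hu hxu => ⟨hx, (infDist_le_dist_of_mem hu).trans hxu.le⟩
  have hdisj : Disjoint (N A) (N B) := by
    rw [Set.disjoint_left]
    intro x hxA hxB
    obtain ⟨u, huA, hu⟩ := hnear ⟨y, hyAB.1⟩ hxA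
    obtain ⟨v, hvB, hv⟩ := hnear ⟨y, hyAB.2⟩ hxB
    obtain ⟨w, hw, hwu⟩ := hLLC.exists_mem_inter_dist_lt hAc.isClosed hBc.isClosed hAB huA hvB
      (δ := 4 * ε) (by linarith [dist_triangle_left u v x])
    -- Here 2ε + 4Lε ≤ 6Lε ≤ t. Yet x is at distance t from y, and at least 2t - t = t from z.
    have hxw : dist x w < t := by
      have := dist_triangle_right x w u
      linarith
    have hxy : dist x y = t := hxA.1
    rw [hinter] at hw
    rcases hw with rfl | rfl
    · linarith
    · linarith [dist_triangle_left w y x]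
  have hcover : ∀ x, dist x y = t → x ∈ N A ∪ N B := by
    intro x hx
    obtain ⟨u, hxu, hu⟩ := Set.not_disjoint_iff.mp (hcon x hx)
    rw [mem_ball'] at hxu
    rw [← hAB] at hu
    exact hu.imp (fun h => hmem hx h hxu) fun h => hmem hx h hxu
  refine false_of_levelSet_split hlift (f := fun x => dist x y) (by fun_prop) (hN A) (hN B) hdisj
    hcover hA hB (fun x hx hxt => hmem hxt hx (by simpa)) (fun x hx hxt => hmem hxt hx (by simpa))
    hyAB hzAB (by simpa using ht0) (by linarith)

/-- If all points were within s of y, the diameter would be at most 2s < r; connectedness then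
supplies the intermediate distance. -/
theorem exists_dist_eq_of_two_mul_lt_ediam {Y : Type*} [MetricSpace Y] [PreconnectedSpace Y]
    (y : Y) {s r : ℝ} (hs : 0 ≤ s) (hsr : 2 * s < r)
    (hr : ENNReal.ofReal r ≤ ediam (univ : Set Y)) : ∃ x, dist x y = s := by
  have hex : ∃ w, s < dist w y := by
    by_contra! hcon
    have hle : ediam (univ : Set Y) ≤ ENNReal.ofReal (2 * s) := by
      refine ediam_le fun a _ b _ => ?_
      rw [edist_dist]
      exact ENNReal.ofReal_le_ofReal (by linarith [dist_triangle_right a b y, hcon a, hcon b])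
    have := hr.trans hle
    rw [ENNReal.ofReal_le_ofReal_iff (by linarith)] at this
    linarith
  obtain ⟨w, hw⟩ := hex
  exact mem_range_of_exists_le_of_exists_ge (f := fun x => dist x y) (by fun_prop)
    ⟨y, by simpa using hs⟩ ⟨w, hw.le⟩

theorem mainTheorem6 {X : Type*} [MetricSpace X] (L : ℝ) (hL : 1 ≤ L)
    (hplane : Nonempty (X ≃ₜ EuclideanSpace ℝ (Fin 2)))
    (hcompact : CompactSpace (UniformSpace.Completion X))
    (hdisk : Nonempty (UniformSpace.Completion X ≃ₜ
      Metric.closedBall (0 : EuclideanSpace ℝ (Fin 2)) 1))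
    (hLLC : IsLLC L (UniformSpace.Completion X))
    (hJordan : IsJordanCurve (metricBoundary X))
    (hboundaryLLC : IsLLC L (metricBoundary X)) :
    IsPorous (2048 * L ^ 5) (metricBoundary X) := by
  obtain ⟨e⟩ := hdisk
  have hconv : Convex ℝ (closedBall (0 : EuclideanSpace ℝ (Fin 2)) 1) := convex_closedBall 0 1
  have hne : (closedBall (0 : EuclideanSpace ℝ (Fin 2)) 1).Nonempty := ⟨0, by simp⟩
  have : PreconnectedSpace (UniformSpace.Completion X) :=
    have := isPreconnected_iff_preconnectedSpace.mp hconv.isPreconnected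
    e.symm.surjective.denseRange.preconnectedSpace e.symm.continuous
  -- A constant linear in L already suffices for the estimates below.
  have hL5 : L ≤ L ^ 5 := le_self_pow₀ hL (by norm_num)
  have hC : 2048 * L ≤ 2048 * L ^ 5 := by linarith
  refine ⟨by linarith, fun y hy r hr hdiam => ?_⟩
  set ε := r / (2048 * L ^ 5)
  have hε : 0 < ε := by positivity
  have hLε : 2048 * L * ε ≤ r := by
    calc 2048 * L * ε ≤ 2048 * L ^ 5 * ε := by gcongr
      _ = r := by simp only [ε]; field_simp
  have hεr : 2048 * ε ≤ r := by nlinarith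
  suffices ∃ x, dist x y ≤ 3 * r / 8 ∧ Disjoint (ball x ε) (metricBoundary X) by
    obtain ⟨x, hx, hdisj⟩ := this
    exact ⟨x, subset_sdiff.mpr ⟨ball_subset_ball' (by linarith), hdisj⟩⟩
  by_cases hz : ∃ z ∈ metricBoundary X, r / 4 ≤ dist z y
  · obtain ⟨z, hz, hzy⟩ := hz
    obtain ⟨x, hx, hdisj⟩ := hJordan.exists_dist_eq_ball_disjoint
      (exists_continuous_lift_circle_exp hconv hne e) hboundaryLLC hy hz (t := r / 8) hε
      (by linarith) (by linarith)
    exact ⟨x, by linarith, hdisj⟩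
  -- Now J lies in B(y, r/4), and r/4 + ε ≤ 3r/8 keeps the ε-ball off J.
  · push Not at hz
    obtain ⟨x, hx⟩ := exists_dist_eq_of_two_mul_lt_ediam y (s := 3 * r / 8) (by linarith)
      (by linarith) hdiam
    refine ⟨x, hx.le, Set.disjoint_left.mpr fun w hwx hw => ?_⟩
    linarith [hz w hw, dist_triangle_left x y w, mem_ball.mp hwx]
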